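/- Let $d\ge 2$ and $T\ge 1$ be integers. Let $\mathcal X\subset\mathbb R^d$ be a closed set, star-convex with respect to the origin, with $\|x\|\le 1$ for all $x\in\mathcal X$. Let $\theta,a\in\mathbb R^d$ satisfy $\|\theta\|\le S_\theta$ and $\|a\|\le S_a$ with $S_\theta,S_a>0$; put $S=\max(S_a,S_\theta)$, let $b>0$ with $\nu:=b/S_a\le 1$, and let $\rho\ge 0$, $\delta\in(0,1)$, $\lambda\ge 1$. Let $\mathcal Y=\{x\in\mathcal X: a^\top x\le b\}$, let $x_*$ maximize $\theta^\top x$ over $\mathcal Y$, and assume $\theta^\top x_*>0$. The reward gap is $$\Delta:=\inf\{\theta^\top(x_*-x)\;:\; x\in\mathcal Y,\ x\ne\alpha x_*\ \text{for all } \alpha>0\}.$$ In each round $t=1,\dots,T$ the learner plays $x_t$ and observes $y_t=\theta^\top x_t+\epsilon_t$ and $z_t=a^\top x_t+\eta_t$, where, for all $s\in\mathbb R$, $\mathbb E[\epsilon_t\mid x_1,\epsilon_1,\dots,\epsilon_{t-1},x_t]=0$ and $\mathbb E[e^{s\epsilon_t}\mid x_1,\epsilon_1,\dots,\epsilon_{t-1},x_t]\le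 e^{s^2\rho^2/2}$, and the same holds with $\eta$ in place of $\epsilon$. The actions are chosen by ROFUL. With $$V_t=\lambda I+\sum_{k<t}x_kx_k^\top,\quad \hat\theta_t=V_t^{-1}\sum_{k<t}x_ky_k,\quad \hat a_t=V_t^{-1}\sum_{k<t}x_kz_k,$$ $$\beta_t=\rho\sqrt{d\log\frac{1+(t-1)/\lambda}{\delta/2}}+\sqrt\lambda\,S,\qquad \|x\|_{V_t^{-1}}=\sqrt{x^\top V_t^{-1}x},$$ in round $t$ the algorithm forms $\mathcal Y_t^p=\{x\in\mathcal X:\hat a_t^\top x+\beta_t\|x\|_{V_t^{-1}}\le b\}$ and $\mathcal Y_t^o=\{x\in\mathcal X:\hat a_t^\top x-\beta_t\|x\|_{V_t^{-1}}\le b\}$, picks any $\tilde x_t\in\operatorname{argmax}_{x\in\mathcal Y_t^o}(\hat\theta_t^\top x+\beta_t\|x\|_{V_t^{-1}})$, sets $\mu_t=\max\{\mu\in[0,1]:\mu\tilde x_t\in\mathcal Y_t^p\}$ and $\gamma_t=\max(\min(\nu/\|\tilde x_t\|,1),\mu_t)$, and plays $x_t=\gamma_t\tilde x_t$. Let $B_T$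 be the number of rounds $t\in\{1,\dots,T\}$ for which there is no $\alpha>0$ with $x_t=\alpha x_*$. If $\Delta>0$, then with probability at least $1-\delta$, $$B_T\le\frac{32\,S^2\beta_T^2\,d}{b^2\Delta^2}\log\Bigl(1+\frac{T}{\lambda d}\Bigr).$$ -/

import Mathlib

open MeasureTheory

noncomputable section

namespace SafeBandit

/-- Euclidean space `ℝ^d`. -/
abbrev Vec (d : ℕ) := EuclideanSpace ℝ (Fin d)

/-- The weighted norm `‖x‖_M = √(xᵀ M x)`. -/
def weightedNorm {d : ℕ} (M : Matrix (Fin d) (Fin d) ℝ) (x : Vec d) : ℝ :=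
  Real.sqrt (dotProduct x.ofLp (M.mulVec x.ofLp))

/-- The regularized design matrix `V_t = ∑_{k=1}^{t-1} x_k x_kᵀ + lam I`. -/
def designMatrix {d : ℕ} (lam : ℝ) (x : ℕ → Vec d) (t : ℕ) : Matrix (Fin d) (Fin d) ℝ :=
  ∑ k ∈ Finset.Ico 1 t, Matrix.vecMulVec (x k).ofLp (x k).ofLp + lam • 1

/-- The regularized least-squares estimate `V_t⁻¹ ∑_{k=1}^{t-1} x_k y_k` from the actions `x` and
the scalar observations `y`. -/
def leastSquares {d : ℕ} (lam : ℝ) (x : ℕ → Vec d) (y : ℕ → ℝ) (t : ℕ) : Vec d :=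
  WithLp.toLp 2
    ((designMatrix lam x t)⁻¹.mulVec (∑ k ∈ Finset.Ico 1 t, y k • x k).ofLp)

/-- The data that the algorithm is given: the action set, the norm bounds for the constraint
vector and the reward vector, the constraint limit, the subgaussian parameter of the noise,
the failure probability and the regularization parameter. -/
structure Input (d : ℕ) where
  actions : Set (Vec d)
  Sa : ℝ
  Stheta : ℝ
  b : ℝ
  rho : ℝ
  delta : ℝ
  lam : ℝ

namespace Input

variable {d : ℕ} (I : Input d)

/-- `S = max (S_a, S_θ)`. -/
def S : ℝ := max I.Sa I.Stheta

/-- `ν = b / S_a`. -/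
def nu : ℝ := I.b / I.Sa

/-- The confidence radius
`β_t = ρ √(d log ((1 + (t - 1) / lam) / (δ / 2))) + √lam S`. -/
def beta (t : ℕ) : ℝ :=
  I.rho * Real.sqrt (d * Real.log ((1 + ((t : ℝ) - 1) / I.lam) / (I.delta / 2)))
    + Real.sqrt I.lam * I.S

/-- The confidence width `β_t ‖v‖_{V_t⁻¹}` of the direction `v` in round `t`. -/
def width (x : ℕ → Vec d) (t : ℕ) (v : Vec d) : ℝ :=
  I.beta t * weightedNorm (designMatrix I.lam x t)⁻¹ v

/-- The pessimistic action set of round `t`; `z` are the noisy constraint observations. -/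
def pessimisticSet (x : ℕ → Vec d) (z : ℕ → ℝ) (t : ℕ) : Set (Vec d) :=
  {v | v ∈ I.actions ∧ inner ℝ (leastSquares I.lam x z t) v + I.width x t v ≤ I.b}

/-- The optimistic action set of round `t`. -/
def optimisticSet (x : ℕ → Vec d) (z : ℕ → ℝ) (t : ℕ) : Set (Vec d) :=
  {v | v ∈ I.actions ∧ inner ℝ (leastSquares I.lam x z t) v - I.width x t v ≤ I.b}

/-- The upper confidence bound on the reward of `v` in round `t`; `y` are the rewards. -/
def ucb (x : ℕ → Vec d) (y : ℕ → ℝ) (t : ℕ) (v : Vec d) : ℝ :=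
  inner ℝ (leastSquares I.lam x y t) v + I.width x t v

/-- The action `x t` is a choice that ROFUL may make in round `t`, given the actions `x k`,
rewards `y k` and constraint observations `z k` of the rounds `1 ≤ k < t` (ties in the choice of
the optimistic action `xopt` are broken arbitrarily). If `xopt = 0` then `mu = 1` and the played
action is `0`, so the value of `nu / ‖xopt‖` is irrelevant in that case. -/
def IsROFULRound (x : ℕ → Vec d) (y z : ℕ → ℝ) (t : ℕ) : Prop :=
  ∃ (xopt : Vec d) (mu : ℝ),
    xopt ∈ I.optimisticSet x z t ∧
    IsMaxOn (I.ucb x y t) (I.optimisticSet x z t) xopt ∧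
    IsGreatest {m : ℝ | m ∈ Set.Icc (0 : ℝ) 1 ∧ m • xopt ∈ I.pessimisticSet x z t} mu ∧
    x t = max (min (I.nu / ‖xopt‖) 1) mu • xopt

/-- The trajectory `x`, `y`, `z` is one of ROFUL run for the rounds `1, …, T`. -/
def IsROFULRun (T : ℕ) (x : ℕ → Vec d) (y z : ℕ → ℝ) : Prop :=
  ∀ t ∈ Finset.Icc 1 T, I.IsROFULRound x y z t

/-- The feasible set `{x ∈ X : aᵀ x ≤ b}` for the constraint vector `a`. -/
def feasibleSet (a : Vec d) : Set (Vec d) :=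
  {v | v ∈ I.actions ∧ inner ℝ a v ≤ I.b}

/-- The direction-wise reward gap: the infimum of `θᵀ (x_* - x)` over the feasible `x` that are
not a positive multiple of `x_*`. -/
def rewardGap (theta a xstar : Vec d) : ℝ :=
  sInf ((fun v => inner ℝ theta (xstar - v)) ''
    {v | v ∈ I.feasibleSet a ∧ ∀ α : ℝ, 0 < α → v ≠ α • xstar})

end Input

open Classical in
/-- The number `B_T` of rounds `1 ≤ t ≤ T` in which the action is not a positive multiple
of `x_*`. -/
def wrongDirections {d : ℕ} (T : ℕ) (x : ℕ → Vec d) (xstar : Vec d) : ℕ :=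
  ((Finset.Icc 1 T).filter (fun t => ¬ ∃ α : ℝ, 0 < α ∧ x t = α • xstar)).card

/-- The σ-algebra generated by `x_1, e_1, …, x_{t-1}, e_{t-1}, x_t`. -/
@[reducible] def history {Ω : Type*} {d : ℕ} (x : ℕ → Ω → Vec d) (e : ℕ → Ω → ℝ) (t : ℕ) :
    MeasurableSpace Ω :=
  (⨆ k ∈ Finset.Icc 1 t, MeasurableSpace.comap (x k) inferInstance) ⊔
    ⨆ k ∈ Finset.Ico 1 t, MeasurableSpace.comap (e k) inferInstance

/-- In every round `1 ≤ t ≤ T` the noise `e_t` has, conditionally on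
`x_1, e_1, …, x_{t-1}, e_{t-1}, x_t`, mean zero and is `rho`-subgaussian. -/
def IsCondSubgaussianNoise {Ω : Type*} [MeasurableSpace Ω] (P : Measure Ω) {d : ℕ}
    (rho : ℝ) (T : ℕ) (x : ℕ → Ω → Vec d) (e : ℕ → Ω → ℝ) : Prop :=
  ∀ t ∈ Finset.Icc 1 T,
    Integrable (e t) P ∧
    P[e t | history x e t] =ᵐ[P] (fun _ => (0 : ℝ)) ∧
    ∀ s : ℝ, Integrable (fun ω => Real.exp (s * e t ω)) P ∧
      P[fun ω => Real.exp (s * e t ω) | history x e t]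
        ≤ᵐ[P] fun _ => Real.exp (s ^ 2 * rho ^ 2 / 2)

end SafeBandit

end

/-! Suppose the confidence bounds around θ and a hold in every round. Then the regret of one round
is at most (4S/b) β_t ‖x_t‖ in the V_t⁻¹-norm (`Input.IsROFULRound.inner_sub_le`). Optimism costs at
most twice the width w of the optimistic action, and shrinking that action by b/(b + 2w) already
makes it pessimistically feasible, so γ_t cannot be small. The played action is feasible, so in a
wrong direction its regret is at least Δ. Hence Δ² ≤ (16S²/b²) β_T² ‖x_t‖² in each wrong round.
Summing against the elliptical potential bound ∑ ‖x_t‖² ≤ 2d log(1 + T/(λd)) gives the count, with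
32 = 16 · 2.

The confidence bounds fail with probability at most δ/2 for each of the two noises. This is the
self-normalized inequality, by the method of mixtures. With S_t the noise sum, M_t = √(λ^d / det
V_t) exp(‖S_t‖²/2) is a nonnegative supermartingale for 1-subgaussian noise, and Ville's inequality
controls all rounds at once. No multivariate Gaussian is integrated: the rank-one update of V_t
makes M_{t+1}/M_t the average of exp(hε_t - h²/2) over a real Gaussian h whose mean and variance are
known before ε_t (`mixtureFactor_succ`, `lintegral_exp_gaussianReal`), and each of these
exponentials has conditional mean at most 1. -/

noncomputable section

namespace SafeBandit

open Matrix

/-! ### Quadratic forms and rank-one updates of positive definite matrices -/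

section LinearAlgebra

variable {n : Type*} [Fintype n]

lemma PosDef.dotProduct_mulVec_comm {M : Matrix n n ℝ} (hM : M.PosDef) (u v : n → ℝ) :
    u ⬝ᵥ M *ᵥ v = v ⬝ᵥ M *ᵥ u := by
  have h : Mᵀ = M := by simpa [Matrix.IsHermitian, conjTranspose_eq_transpose_of_trivial] using hM.1
  rw [dotProduct_mulVec, ← mulVec_transpose, h, dotProduct_comm]

lemma PosDef.dotProduct_mulVec_self_nonneg {M : Matrix n n ℝ} (hM : M.PosDef) (u : n → ℝ) :
    0 ≤ u ⬝ᵥ M *ᵥ u := by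
  simpa using hM.posSemidef.dotProduct_mulVec_nonneg u

/-- The Cauchy-Schwarz inequality for the form of a positive definite matrix. -/
lemma PosDef.sq_dotProduct_mulVec_le {M : Matrix n n ℝ} (hM : M.PosDef) (u v : n → ℝ) :
    (u ⬝ᵥ M *ᵥ v) ^ 2 ≤ (u ⬝ᵥ M *ᵥ u) * (v ⬝ᵥ M *ᵥ v) := by
  have h := discrim_le_zero (a := v ⬝ᵥ M *ᵥ v) (b := 2 * (u ⬝ᵥ M *ᵥ v)) (c := u ⬝ᵥ M *ᵥ u)
    (fun r => by
      have := PosDef.dotProduct_mulVec_self_nonneg hM (u + r • v)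
      simp only [mulVec_add, mulVec_smul, add_dotProduct, dotProduct_add, smul_dotProduct,
        dotProduct_smul, smul_eq_mul] at this
      rw [PosDef.dotProduct_mulVec_comm hM v u] at this
      linarith)
  rw [discrim] at h
  nlinarith

variable [DecidableEq n]

lemma PosDef.mulVec_inv_mulVec {M : Matrix n n ℝ} (hM : M.PosDef) (u : n → ℝ) :
    M *ᵥ (M⁻¹ *ᵥ u) = u := by
  rw [mulVec_mulVec, mul_nonsing_inv _ ((isUnit_iff_isUnit_det _).1 hM.isUnit), one_mulVec]

lemma PosDef.inv_mulVec_eq {M : Matrix n n ℝ} (hM : M.PosDef) {u v : n → ℝ} (h : M *ᵥ v = u) :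
    M⁻¹ *ᵥ u = v := by
  rw [← h, mulVec_mulVec, nonsing_inv_mul _ ((isUnit_iff_isUnit_det _).1 hM.isUnit), one_mulVec]

/-- The Sherman-Morrison formula. -/
lemma PosDef.inv_add_vecMulVec_mulVec {M : Matrix n n ℝ} (hM : M.PosDef) (x u : n → ℝ) :
    (M + vecMulVec x x)⁻¹ *ᵥ u =
      M⁻¹ *ᵥ u - ((x ⬝ᵥ M⁻¹ *ᵥ u) / (1 + x ⬝ᵥ M⁻¹ *ᵥ x)) • (M⁻¹ *ᵥ x) := by
  have hq : 0 < 1 + x ⬝ᵥ M⁻¹ *ᵥ x := by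
    have := PosDef.dotProduct_mulVec_self_nonneg hM.inv x
    linarith
  have hpd : (M + vecMulVec x x).PosDef :=
    hM.add_posSemidef (by simpa using posSemidef_vecMulVec_self_star (R := ℝ) x)
  apply PosDef.inv_mulVec_eq hpd
  rw [add_mulVec, mulVec_sub, mulVec_smul, PosDef.mulVec_inv_mulVec hM,
    PosDef.mulVec_inv_mulVec hM, vecMulVec_mulVec, dotProduct_sub, dotProduct_smul]
  ext i
  simp
  field_simp
  ring

/-- Expansion by Sherman-Morrison. With u the noise sum and e the new noise, this is the one-round
change of the exponent of the mixture process. -/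
lemma PosDef.dotProduct_inv_add_vecMulVec_mulVec {M : Matrix n n ℝ} (hM : M.PosDef)
    (x u : n → ℝ) (e : ℝ) :
    (u + e • x) ⬝ᵥ (M + vecMulVec x x)⁻¹ *ᵥ (u + e • x) = u ⬝ᵥ M⁻¹ *ᵥ u +
      (2 * e * (x ⬝ᵥ M⁻¹ *ᵥ u) + e ^ 2 * (x ⬝ᵥ M⁻¹ *ᵥ x) - (x ⬝ᵥ M⁻¹ *ᵥ u) ^ 2) /
        (1 + x ⬝ᵥ M⁻¹ *ᵥ x) := by
  have hq : 0 < 1 + x ⬝ᵥ M⁻¹ *ᵥ x := by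
    have := PosDef.dotProduct_mulVec_self_nonneg hM.inv x
    linarith
  rw [PosDef.inv_add_vecMulVec_mulVec hM]
  simp only [mulVec_add, mulVec_smul, add_dotProduct, dotProduct_add, smul_dotProduct,
        dotProduct_smul, smul_eq_mul, dotProduct_sub]
  rw [PosDef.dotProduct_mulVec_comm hM.inv u x]
  field_simp
  ring

lemma PosDef.det_add_vecMulVec {M : Matrix n n ℝ} (hM : M.PosDef) (x : n → ℝ) :
    (M + vecMulVec x x).det = M.det * (1 + x ⬝ᵥ M⁻¹ *ᵥ x) := by
  rw [vecMulVec_eq Unit, det_add_replicateCol_mul_replicateRow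
    ((isUnit_iff_isUnit_det _).1 hM.isUnit)]
  congr 1
  rw [det_unique, Matrix.add_apply, one_apply_eq, Matrix.mul_assoc, ← replicateCol_mulVec,
    replicateRow_mul_replicateCol_apply]

/-- The arithmetic-geometric mean inequality for the eigenvalues. -/
lemma PosDef.log_det_le {M : Matrix n n ℝ} (hM : M.PosDef) [Nonempty n] :
    Real.log M.det ≤ Fintype.card n * Real.log (M.trace / Fintype.card n) := by
  have hev := hM.eigenvalues_pos
  have hc : (0 : ℝ) < Fintype.card n := by exact_mod_cast Fintype.card_pos
  have hdet : M.det = ∏ i, hM.1.eigenvalues i := by simpa using hM.1.det_eq_prod_eigenvalues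
  have htr : M.trace = ∑ i, hM.1.eigenvalues i := by simpa using hM.1.trace_eq_sum_eigenvalues
  have hpos : 0 < M.trace := by
    rw [htr]; exact Finset.sum_pos (fun i _ => hev i) Finset.univ_nonempty
  have key := strictConcaveOn_log_Ioi.concaveOn.le_map_sum (t := Finset.univ)
    (w := fun _ : n => (Fintype.card n : ℝ)⁻¹) (p := hM.1.eigenvalues) (by intros; positivity)
    (by simp [hc.ne']) (fun i _ => hev i)
  simp only [smul_eq_mul, ← Finset.mul_sum] at key
  rw [← htr, ← Real.log_prod (fun i _ => (hev i).ne'), ← hdet, inv_mul_le_iff₀ hc,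
    inv_mul_eq_div] at key
  exact key

end LinearAlgebra

/-! ### Design matrix, elliptical potential, least-squares error -/

section DesignMatrix

variable {d : ℕ} {lam : ℝ}

lemma designMatrix_one (x : ℕ → Vec d) : designMatrix lam x 1 = lam • 1 := by
  simp [designMatrix]

lemma designMatrix_succ (x : ℕ → Vec d) {t : ℕ} (ht : 1 ≤ t) :
    designMatrix lam x (t + 1) =
      designMatrix lam x t + vecMulVec (x t).ofLp (x t).ofLp := by
  rw [designMatrix, designMatrix, Finset.sum_Ico_succ_top ht]
  abel

lemma designMatrix_posDef (hlam : 0 < lam) (x : ℕ → Vec d) (t : ℕ) :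
    (designMatrix lam x t).PosDef := by
  refine Matrix.PosDef.posSemidef_add (posSemidef_sum _ fun k _ => ?_) (PosDef.one.smul hlam)
  simpa using posSemidef_vecMulVec_self_star (R := ℝ) (x k).ofLp

lemma norm_sq_eq_dotProduct (v : Vec d) : ‖v‖ ^ 2 = v.ofLp ⬝ᵥ v.ofLp := by
  rw [EuclideanSpace.real_norm_sq_eq]
  simp [dotProduct, sq]

lemma trace_designMatrix_le (x : ℕ → Vec d) (t : ℕ) (hx : ∀ k ∈ Finset.Ico 1 t, ‖x k‖ ≤ 1) :
    (designMatrix lam x t).trace ≤ (t - 1 : ℕ) + lam * d := by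
  rw [designMatrix, trace_add, trace_smul, trace_one, trace_sum, Fintype.card_fin, smul_eq_mul]
  gcongr
  calc _ ≤ ∑ k ∈ Finset.Ico 1 t, (1 : ℝ) := Finset.sum_le_sum fun k hk => by
        rw [trace_vecMulVec, ← norm_sq_eq_dotProduct]
        exact pow_le_one₀ (norm_nonneg _) (hx k hk)
    _ = _ := by simp

lemma log_det_designMatrix_le (hd : 0 < d) (hlam : 0 < lam) (x : ℕ → Vec d) (t : ℕ)
    (hx : ∀ k ∈ Finset.Ico 1 t, ‖x k‖ ≤ 1) :
    Real.log (designMatrix lam x t).det - d * Real.log lam ≤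
      d * Real.log (1 + (t - 1 : ℕ) / (lam * d)) := by
  have : Nonempty (Fin d) := ⟨⟨0, hd⟩⟩
  have hd' : (0 : ℝ) < d := by exact_mod_cast hd
  have h1 := PosDef.log_det_le (designMatrix_posDef hlam x t)
  have h2 := trace_designMatrix_le (lam := lam) x t hx
  have hpos := (designMatrix_posDef hlam x t).trace_pos
  rw [Fintype.card_fin] at h1
  have h3 : (designMatrix lam x t).trace / d ≤ lam * (1 + (t - 1 : ℕ) / (lam * d)) := by
    rw [div_le_iff₀ hd']
    refine h2.trans_eq ?_
    field_simp
    ring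
  have h4 := Real.log_le_log (by positivity) h3
  rw [Real.log_mul hlam.ne' (by positivity)] at h4
  have := mul_le_mul_of_nonneg_left h4 hd'.le
  linarith

lemma mul_dotProduct_self_le (x : ℕ → Vec d) (t : ℕ) (v : Fin d → ℝ) :
    lam * (v ⬝ᵥ v) ≤ v ⬝ᵥ designMatrix lam x t *ᵥ v := by
  rw [designMatrix, add_mulVec, dotProduct_add, smul_mulVec, one_mulVec, dotProduct_smul,
    smul_eq_mul, sum_mulVec, dotProduct_sum]
  simp only [vecMulVec_mulVec]
  have : 0 ≤ ∑ k ∈ Finset.Ico 1 t,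
      v ⬝ᵥ (MulOpposite.op ((x k).ofLp ⬝ᵥ v) • (x k).ofLp) := by
    refine Finset.sum_nonneg fun k _ => ?_
    have : v ⬝ᵥ (MulOpposite.op ((x k).ofLp ⬝ᵥ v) • (x k).ofLp) =
      ((x k).ofLp ⬝ᵥ v) ^ 2 := by
        rw [op_smul_eq_smul, dotProduct_smul, dotProduct_comm v, smul_eq_mul, sq]
    rw [this]
    positivity
  linarith

/-- Inverting V ≥ λI. With w = V⁻¹v, the bound λ‖w‖² ≤ vᵀw and Cauchy-Schwarz give λ(vᵀw)² ≤ ‖v‖²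
vᵀw, and one factor vᵀw cancels. -/
lemma dotProduct_inv_designMatrix_mulVec_le (hlam : 0 < lam) (x : ℕ → Vec d) (t : ℕ)
    (v : Fin d → ℝ) :
    lam * (v ⬝ᵥ (designMatrix lam x t)⁻¹ *ᵥ v) ≤ v ⬝ᵥ v := by
  set V := designMatrix lam x t
  have hV : V.PosDef := designMatrix_posDef hlam x t
  set w := V⁻¹ *ᵥ v
  have hw : V *ᵥ w = v := PosDef.mulVec_inv_mulVec hV v
  have h1 : lam * (w ⬝ᵥ w) ≤ w ⬝ᵥ V *ᵥ w := mul_dotProduct_self_le x t w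
  rw [hw, dotProduct_comm w v] at h1
  have h2 : (v ⬝ᵥ w) ^ 2 ≤ (v ⬝ᵥ v) * (w ⬝ᵥ w) := by
    simpa using PosDef.sq_dotProduct_mulVec_le (PosDef.one (n := Fin d) (R := ℝ)) v w
  have h3 : 0 ≤ v ⬝ᵥ w := PosDef.dotProduct_mulVec_self_nonneg hV.inv v
  have h4 : 0 ≤ v ⬝ᵥ v := by
    simpa using PosDef.dotProduct_mulVec_self_nonneg (PosDef.one (n := Fin d) (R := ℝ)) v
  rcases h3.eq_or_lt with h | h
  · rw [← h]; simpa using h4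
  · have : lam * (v ⬝ᵥ w) * (v ⬝ᵥ w) ≤ (v ⬝ᵥ v) * (v ⬝ᵥ w) := by nlinarith
    exact le_of_mul_le_mul_right this h

/-- The elliptical potential lemma. -/
lemma sum_dotProduct_inv_designMatrix_le (hlam : 1 ≤ lam) (x : ℕ → Vec d) (T : ℕ)
    (hx : ∀ k ∈ Finset.Icc 1 T, ‖x k‖ ≤ 1) :
    ∑ t ∈ Finset.Icc 1 T, (x t).ofLp ⬝ᵥ (designMatrix lam x t)⁻¹ *ᵥ (x t).ofLp ≤
      2 * (Real.log (designMatrix lam x (T + 1)).det - d * Real.log lam) := by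
  have hlam0 : 0 < lam := by linarith
  induction T with
  | zero => simp [designMatrix_one]
  | succ T ih =>
    rw [Finset.sum_Icc_succ_top (by omega), designMatrix_succ x (by omega : 1 ≤ T + 1)]
    specialize ih fun k hk => hx k (by simp at hk ⊢; omega)
    have hV := designMatrix_posDef hlam0 x (T + 1)
    rw [PosDef.det_add_vecMulVec hV]
    set q := (x (T + 1)).ofLp ⬝ᵥ (designMatrix lam x (T + 1))⁻¹ *ᵥ (x (T + 1)).ofLp
    have hq0 : 0 ≤ q := PosDef.dotProduct_mulVec_self_nonneg hV.inv _
    -- λ ≥ 1 enters here; q ≤ 1 is what makes q ≤ 2 log(1 + q) available below, turning the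
    -- potential into a telescoping log-determinant.
    have hq1 : q ≤ 1 := by
      have h1 := dotProduct_inv_designMatrix_mulVec_le hlam0 x (T + 1) (x (T + 1)).ofLp
      rw [← norm_sq_eq_dotProduct] at h1
      have h2 := pow_le_one₀ (n := 2) (norm_nonneg _) (hx (T + 1) (by simp))
      nlinarith
    rw [Real.log_mul hV.det_pos.ne' (by positivity)]
    have : q ≤ 2 * Real.log (1 + q) := by
      have h := Real.one_sub_inv_le_log_of_pos (by positivity : 0 < 1 + q)
      have h' : q / 2 ≤ 1 - (1 + q)⁻¹ := by
        rw [← sub_nonneg]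
        have : 1 - (1 + q)⁻¹ - q / 2 = q * (1 - q) / (2 * (1 + q)) := by field_simp; ring
        rw [this]
        exact div_nonneg (mul_nonneg hq0 (by linarith)) (by positivity)
      linarith
    linarith

lemma weightedNorm_sq {M : Matrix (Fin d) (Fin d) ℝ} (hM : M.PosDef) (v : Vec d) :
    weightedNorm M v ^ 2 = v.ofLp ⬝ᵥ M *ᵥ v.ofLp :=
  Real.sq_sqrt (PosDef.dotProduct_mulVec_self_nonneg hM _)

lemma weightedNorm_nonneg (M : Matrix (Fin d) (Fin d) ℝ) (v : Vec d) : 0 ≤ weightedNorm M v :=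
  Real.sqrt_nonneg _

lemma weightedNorm_smul (M : Matrix (Fin d) (Fin d) ℝ) {r : ℝ} (hr : 0 ≤ r) (v : Vec d) :
    weightedNorm M (r • v) = r * weightedNorm M v := by
  rw [weightedNorm, weightedNorm, WithLp.ofLp_smul, mulVec_smul, smul_dotProduct, dotProduct_smul,
    smul_smul, smul_eq_mul, Real.sqrt_mul (by positivity), Real.sqrt_mul_self hr]

lemma abs_dotProduct_mulVec_le {M : Matrix (Fin d) (Fin d) ℝ} (hM : M.PosDef) (u v : Vec d) :
    |u.ofLp ⬝ᵥ M *ᵥ v.ofLp| ≤ weightedNorm M u * weightedNorm M v := by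
  apply abs_le_of_sq_le_sq _ (mul_nonneg (weightedNorm_nonneg _ _) (weightedNorm_nonneg _ _))
  rw [mul_pow, weightedNorm_sq hM, weightedNorm_sq hM]
  exact PosDef.sq_dotProduct_mulVec_le hM _ _

lemma inner_eq_dotProduct (u v : Vec d) : inner ℝ u v = v.ofLp ⬝ᵥ u.ofLp := by
  simp [PiLp.inner_apply, dotProduct]

/-- The noise part `∑_{k=1}^{t-1} e_k x_k` of the least-squares data. -/
def noiseSum (x : ℕ → Vec d) (e : ℕ → ℝ) (t : ℕ) : Vec d := ∑ k ∈ Finset.Ico 1 t, e k • x k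

/-- The error of the least-squares estimate is bounded by the self-normalized noise and the bias
of the regularization. -/
lemma abs_inner_leastSquares_sub_le (hlam : 0 < lam) (x : ℕ → Vec d) (e : ℕ → ℝ) (theta : Vec d)
    (t : ℕ) (v : Vec d) :
    |inner ℝ (leastSquares lam x (fun k => inner ℝ theta (x k) + e k) t) v - inner ℝ theta v| ≤
      (weightedNorm (designMatrix lam x t)⁻¹ (noiseSum x e t) + Real.sqrt lam * ‖theta‖) *
        weightedNorm (designMatrix lam x t)⁻¹ v := by
  have hV := designMatrix_posDef hlam x t
  -- The data vector is V_tθ + (S_t - λθ), so the estimation error is V_t⁻¹S_t minus the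
  -- regularization bias λV_t⁻¹θ.
  have hsum : (∑ k ∈ Finset.Ico 1 t, (inner ℝ theta (x k) + e k) • x k).ofLp =
      designMatrix lam x t *ᵥ theta.ofLp + ((noiseSum x e t).ofLp - lam • theta.ofLp) := by
    rw [designMatrix, add_mulVec, smul_mulVec, one_mulVec, sum_mulVec, noiseSum]
    simp only [add_smul, Finset.sum_add_distrib, WithLp.ofLp_add, WithLp.ofLp_sum,
      WithLp.ofLp_smul, vecMulVec_mulVec, op_smul_eq_smul, inner_eq_dotProduct]
    abel
  have hest : inner ℝ (leastSquares lam x (fun k => inner ℝ theta (x k) + e k) t) v -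
      inner ℝ theta v = v.ofLp ⬝ᵥ (designMatrix lam x t)⁻¹ *ᵥ (noiseSum x e t).ofLp -
        lam * (v.ofLp ⬝ᵥ (designMatrix lam x t)⁻¹ *ᵥ theta.ofLp) := by
    rw [inner_eq_dotProduct, inner_eq_dotProduct, leastSquares, hsum]
    rw [mulVec_add, PosDef.inv_mulVec_eq hV rfl, dotProduct_add, mulVec_sub, mulVec_smul,
      dotProduct_sub, dotProduct_smul, smul_eq_mul]
    ring
  have hbias : lam * weightedNorm (designMatrix lam x t)⁻¹ theta ≤ Real.sqrt lam * ‖theta‖ := by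
    have h0 := weightedNorm_nonneg (designMatrix lam x t)⁻¹ theta
    apply le_of_sq_le_sq _ (by positivity)
    rw [mul_pow, mul_pow, Real.sq_sqrt hlam.le, weightedNorm_sq hV.inv, norm_sq_eq_dotProduct]
    have := dotProduct_inv_designMatrix_mulVec_le hlam x t theta.ofLp
    nlinarith
  rw [hest]
  have h1 := abs_dotProduct_mulVec_le hV.inv v (noiseSum x e t)
  have h2 := abs_dotProduct_mulVec_le hV.inv v theta
  have h3 := weightedNorm_nonneg (designMatrix lam x t)⁻¹ v
  calc _ ≤ _ := abs_sub _ _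
    _ ≤ weightedNorm (designMatrix lam x t)⁻¹ v *
          weightedNorm (designMatrix lam x t)⁻¹ (noiseSum x e t) +
        lam * (weightedNorm (designMatrix lam x t)⁻¹ v *
          weightedNorm (designMatrix lam x t)⁻¹ theta) := by
      rw [abs_mul, abs_of_pos hlam]
      gcongr
    _ ≤ _ := by nlinarith

end DesignMatrix

end SafeBandit
end

noncomputable section

namespace SafeBandit

open scoped ENNReal
open ProbabilityTheory Filter Topology

/-! ### Conditional subgaussianity with random exponents and Gaussian mixing -/

section Subgaussian

variable {Ω : Type*} {m mΩ : MeasurableSpace Ω} {P : Measure Ω}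

/-- Integrated form of the `1`-subgaussianity of `e` given the σ-algebra `m`. -/
def SubgaussianGiven {Ω : Type*} (m : MeasurableSpace Ω) {mΩ : MeasurableSpace Ω} (P : Measure Ω)
     (e : Ω → ℝ) : Prop :=
  ∀ s : ℝ, ∀ W : Ω → ℝ≥0∞, Measurable[m] W →
    ∫⁻ ω, W ω * ENNReal.ofReal (Real.exp (s * e ω - s ^ 2 / 2)) ∂P ≤ ∫⁻ ω, W ω ∂P

lemma lintegral_mul_ofReal_le_of_condExp_le [IsFiniteMeasure P]
    (hm : m ≤ mΩ) {f : Ω → ℝ} (hf : Measurable f) (hf0 : ∀ ω, 0 ≤ f ω) (hfi : Integrable f P)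
    {c : ℝ} (hc : P[f | m] ≤ᵐ[P] fun _ => c) {W : Ω → ℝ≥0∞} (hW : Measurable[m] W) :
    ∫⁻ ω, W ω * ENNReal.ofReal (f ω) ∂P ≤ ENNReal.ofReal c * ∫⁻ ω, W ω ∂P := by
  -- The conditional bound says exactly that f·P ≤ c·P on the sets of `m`; integrating an
  -- `m`-measurable weight against both measures is then monotone.
  have hle : (P.withDensity fun ω => ENNReal.ofReal (f ω)).trim hm ≤
      (ENNReal.ofReal c • P).trim hm := by
    refine Measure.le_iff.2 fun s hs => ?_
    rw [trim_measurableSet_eq hm hs, trim_measurableSet_eq hm hs, withDensity_apply _ (hm s hs),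
      ← ofReal_integral_eq_lintegral_ofReal hfi.integrableOn (ae_of_all _ hf0),
      ← setIntegral_condExp hm hfi hs]
    calc _ ≤ ENNReal.ofReal (∫ _ in s, c ∂P) := by
          refine ENNReal.ofReal_le_ofReal ?_
          exact setIntegral_mono_ae integrable_condExp.integrableOn
            (integrable_const c).integrableOn hc
      _ = _ := by
          rw [setIntegral_const, smul_eq_mul, mul_comm, Measure.smul_apply, smul_eq_mul,
            ENNReal.ofReal_mul' measureReal_nonneg, ofReal_measureReal]
  have h := lintegral_mono' hle (le_refl W)
  rw [lintegral_trim hm hW, lintegral_trim hm hW,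
    lintegral_withDensity_eq_lintegral_mul _ hf.ennreal_ofReal (hW.mono hm le_rfl),
    lintegral_smul_measure] at h
  simpa [mul_comm] using h

/-- On each level set of h the exponent is constant, and the indicator of the level set can be
absorbed into the weight W. -/
lemma SubgaussianGiven.lintegral_le_of_finite_range (hm : m ≤ mΩ) {e : Ω → ℝ}
    (he : Measurable e) (hsub : SubgaussianGiven m P e) {h : Ω → ℝ}
    (hh : Measurable[m] h) (hfin : (Set.range h).Finite)
    {W : Ω → ℝ≥0∞} (hW : Measurable[m] W) :
    ∫⁻ ω, W ω * ENNReal.ofReal (Real.exp (h ω * e ω - h ω ^ 2 / 2)) ∂P ≤ ∫⁻ ω, W ω ∂P := by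
  have hset : ∀ r, MeasurableSet[m] (h ⁻¹' {r}) := fun r => hh (measurableSet_singleton r)
  have hWr : ∀ r, Measurable[m] ((h ⁻¹' {r}).indicator W) := fun r => hW.indicator (hset r)
  have hsum : ∀ ω, ∀ g : ℝ → ℝ≥0∞, ∑ r ∈ hfin.toFinset, (h ⁻¹' {r}).indicator W ω * g r =
      W ω * g (h ω) := by
    intro ω g
    rw [Finset.sum_eq_single (h ω)]
    · simp
    · intro r _ hr
      rw [Set.indicator_of_notMem, zero_mul]
      simpa using hr.symm
    · intro hn
      exact absurd (hfin.mem_toFinset.2 (Set.mem_range_self ω)) hn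
  calc _ = ∫⁻ ω, ∑ r ∈ hfin.toFinset, (h ⁻¹' {r}).indicator W ω *
          ENNReal.ofReal (Real.exp (r * e ω - r ^ 2 / 2)) ∂P := by
        refine lintegral_congr fun ω => ?_
        rw [hsum ω (fun r => ENNReal.ofReal (Real.exp (r * e ω - r ^ 2 / 2)))]
    _ = ∑ r ∈ hfin.toFinset, ∫⁻ ω, (h ⁻¹' {r}).indicator W ω *
          ENNReal.ofReal (Real.exp (r * e ω - r ^ 2 / 2)) ∂P := by
        refine lintegral_finsetSum _ fun r _ => ?_
        exact ((hWr r).mono hm le_rfl).mul (by fun_prop)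
    _ ≤ ∑ r ∈ hfin.toFinset, ∫⁻ ω, (h ⁻¹' {r}).indicator W ω ∂P :=
        Finset.sum_le_sum fun r _ => hsub r _ (hWr r)
    _ = ∫⁻ ω, ∑ r ∈ hfin.toFinset, (h ⁻¹' {r}).indicator W ω ∂P :=
        (lintegral_finsetSum _ fun r _ => (hWr r).mono hm le_rfl).symm
    _ = _ := by
        refine lintegral_congr fun ω => ?_
        simpa using hsum ω (fun _ => 1)

/-- The exponent may be random, as long as it is measurable with respect to `m`. -/
lemma SubgaussianGiven.lintegral_le (hm : m ≤ mΩ) {e : Ω → ℝ}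
    (he : Measurable e) (hsub : SubgaussianGiven m P e) {h : Ω → ℝ} (hh : Measurable[m] h)
    {W : Ω → ℝ≥0∞} (hW : Measurable[m] W) (hWtop : ∀ ω, W ω ≠ ∞) :
    ∫⁻ ω, W ω * ENNReal.ofReal (Real.exp (h ω * e ω - h ω ^ 2 / 2)) ∂P ≤ ∫⁻ ω, W ω ∂P := by
  have hs : StronglyMeasurable[m] h := hh.stronglyMeasurable
  have happrox : ∀ n, Measurable[m] (hs.approx n) := fun n =>
    @SimpleFunc.measurable _ _ m _ (hs.approx n)
  have hmeas : ∀ n, Measurable fun ω =>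
      W ω * ENNReal.ofReal (Real.exp (hs.approx n ω * e ω - hs.approx n ω ^ 2 / 2)) := by
    intro n
    have h1 : Measurable (hs.approx n) := (happrox n).mono hm le_rfl
    have h2 : Measurable W := hW.mono hm le_rfl
    fun_prop
  have hlim : ∀ ω, Tendsto (fun n => W ω *
      ENNReal.ofReal (Real.exp (hs.approx n ω * e ω - hs.approx n ω ^ 2 / 2))) atTop
      (𝓝 (W ω * ENNReal.ofReal (Real.exp (h ω * e ω - h ω ^ 2 / 2)))) := by
    intro ω
    refine ENNReal.Tendsto.const_mul ?_ (Or.inr (hWtop ω))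
    have h1 := hs.tendsto_approx ω
    refine (ENNReal.continuous_ofReal.tendsto _).comp ((Real.continuous_exp.tendsto _).comp ?_)
    exact (h1.mul_const _).sub ((h1.pow 2).div_const 2)
  -- Fatou's lemma along simple approximations of h; finiteness of W makes the products converge
  -- pointwise.
  calc _ = ∫⁻ ω, liminf (fun n => W ω * ENNReal.ofReal
            (Real.exp (hs.approx n ω * e ω - hs.approx n ω ^ 2 / 2))) atTop ∂P :=
        lintegral_congr fun ω => (hlim ω).liminf_eq.symm
    _ ≤ liminf (fun n => ∫⁻ ω, W ω * ENNReal.ofReal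
            (Real.exp (hs.approx n ω * e ω - hs.approx n ω ^ 2 / 2)) ∂P) atTop :=
        lintegral_liminf_le hmeas
    _ ≤ liminf (fun _ : ℕ => ∫⁻ ω, W ω ∂P) atTop :=
        liminf_le_liminf (Eventually.of_forall fun n =>
          hsub.lintegral_le_of_finite_range hm he (happrox n)
            (@SimpleFunc.finite_range _ _ m (hs.approx n)) hW)
    _ = _ := by simp

lemma lintegral_exp_gaussianReal (c r e : ℝ) :
    ∫⁻ z, ENNReal.ofReal (Real.exp ((c + r * z) * e - (c + r * z) ^ 2 / 2)) ∂gaussianReal 0 1 =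
      ENNReal.ofReal ((Real.sqrt (1 + r ^ 2))⁻¹ *
        Real.exp ((2 * e * c + e ^ 2 * r ^ 2 - c ^ 2) / (2 * (1 + r ^ 2)))) := by
  have hr : 0 < 1 + r ^ 2 := by positivity
  set v : NNReal := ⟨(1 + r ^ 2)⁻¹, by positivity⟩ with hv
  have hvc : (v : ℝ) = (1 + r ^ 2)⁻¹ := rfl
  have hv0 : v ≠ 0 := by
    intro h
    have : (v : ℝ) = 0 := by rw [h]; rfl
    rw [hvc] at this
    exact (inv_pos.2 hr).ne' this
  rw [gaussianReal_of_var_ne_zero 0 one_ne_zero,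
    lintegral_withDensity_eq_lintegral_mul _ (measurable_gaussianPDF 0 1) (by fun_prop)]
  set K := (Real.sqrt (1 + r ^ 2))⁻¹ *
        Real.exp ((2 * e * c + e ^ 2 * r ^ 2 - c ^ 2) / (2 * (1 + r ^ 2)))
  -- Completing the square in z leaves a Gaussian density of mean (e - c)r/(1 + r²) and variance
  -- 1/(1 + r²), times a constant.
  calc _ = ∫⁻ z, ENNReal.ofReal K * gaussianPDF ((e - c) * r / (1 + r ^ 2)) v z := by
        refine lintegral_congr fun z => ?_
        rw [Pi.mul_apply, gaussianPDF, gaussianPDF, ← ENNReal.ofReal_mul (gaussianPDFReal_nonneg _ _ _),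
          ← ENNReal.ofReal_mul (by positivity), gaussianPDFReal, gaussianPDFReal]
        congr 1
        have h1 : Real.sqrt (2 * Real.pi * v) =
            Real.sqrt (2 * Real.pi) * (Real.sqrt (1 + r ^ 2))⁻¹ := by
          rw [hvc, Real.sqrt_mul (by positivity), Real.sqrt_inv]
        rw [h1, hvc, mul_assoc, ← Real.exp_add, mul_inv, inv_inv]
        have h2 : ∀ a b x y : ℝ, b ≠ 0 → b⁻¹ * Real.exp x * (a * b * Real.exp y) =
            a * Real.exp (x + y) := by
          intro a b x y hb
          rw [Real.exp_add]; field_simp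
        rw [h2 _ _ _ _ (by positivity)]
        congr 2
        · simp
        · simp only [NNReal.coe_one]
          field_simp
          ring
    _ = _ := by
        rw [lintegral_const_mul _ (measurable_gaussianPDF _ _), lintegral_gaussianPDF_eq_one _ hv0,
          mul_one]

/-- Gaussian mixing of the exponent, with a mean and a variance that are measurable with respect
to `m`. -/
lemma SubgaussianGiven.lintegral_mixture_le [SFinite P] (hm : m ≤ mΩ)
    {e : Ω → ℝ} (he : Measurable e) (hsub : SubgaussianGiven m P e) {c q : Ω → ℝ}
    (hc : Measurable[m] c) (hq : Measurable[m] q) (hq0 : ∀ ω, 0 ≤ q ω)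
    {W : Ω → ℝ≥0∞} (hW : Measurable[m] W) (hWtop : ∀ ω, W ω ≠ ∞) :
    ∫⁻ ω, W ω * ENNReal.ofReal ((Real.sqrt (1 + q ω))⁻¹ *
      Real.exp ((2 * e ω * c ω + e ω ^ 2 * q ω - c ω ^ 2) / (2 * (1 + q ω)))) ∂P ≤
      ∫⁻ ω, W ω ∂P := by
  have hW' : Measurable W := hW.mono hm le_rfl
  have hc' : Measurable c := hc.mono hm le_rfl
  have hq' : Measurable q := hq.mono hm le_rfl
  calc _ = ∫⁻ ω, ∫⁻ z, W ω * ENNReal.ofReal (Real.exp ((c ω + Real.sqrt (q ω) * z) * e ω -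
            (c ω + Real.sqrt (q ω) * z) ^ 2 / 2)) ∂gaussianReal 0 1 ∂P := by
        refine lintegral_congr fun ω => ?_
        rw [lintegral_const_mul _ (by fun_prop), lintegral_exp_gaussianReal, Real.sq_sqrt (hq0 ω)]
    _ = ∫⁻ z, ∫⁻ ω, W ω * ENNReal.ofReal (Real.exp ((c ω + Real.sqrt (q ω) * z) * e ω -
            (c ω + Real.sqrt (q ω) * z) ^ 2 / 2)) ∂P ∂gaussianReal 0 1 := by
        refine lintegral_lintegral_swap (Measurable.aemeasurable ?_)
        have h1 : Measurable fun p : Ω × ℝ => W p.1 := hW'.comp measurable_fst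
        have h2 : Measurable fun p : Ω × ℝ => c p.1 := hc'.comp measurable_fst
        have h3 : Measurable fun p : Ω × ℝ => q p.1 := hq'.comp measurable_fst
        have h4 : Measurable fun p : Ω × ℝ => e p.1 := he.comp measurable_fst
        simp only [Function.uncurry_def]
        fun_prop
    _ ≤ ∫⁻ _, ∫⁻ ω, W ω ∂P ∂gaussianReal 0 1 := by
        refine lintegral_mono fun z => ?_
        refine hsub.lintegral_le hm he (h := fun ω => c ω + Real.sqrt (q ω) * z) ?_ hW hWtop
        exact hc.add ((Real.continuous_sqrt.measurable.comp hq).mul_const z)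
    _ = _ := by simp

end Subgaussian

end SafeBandit
end

noncomputable section

namespace SafeBandit

open scoped ENNReal
open ProbabilityTheory Filter Topology Matrix

/-! ### Measurability of determinants and inverses -/

section MatrixMeasurability

variable {Ω : Type*} [MeasurableSpace Ω] {n : Type*} [Fintype n] [DecidableEq n]

lemma measurable_det {A : Ω → Matrix n n ℝ} (hA : ∀ i j, Measurable fun ω => A ω i j) :
    Measurable fun ω => (A ω).det := by
  simp only [det_apply']
  refine Finset.measurable_sum _ fun σ _ => ?_
  exact (Finset.measurable_prod _ fun i _ => hA _ _).const_mul _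

lemma measurable_inv_apply {A : Ω → Matrix n n ℝ} (hA : ∀ i j, Measurable fun ω => A ω i j)
    (i j : n) : Measurable fun ω => (A ω)⁻¹ i j := by
  simp only [inv_def, Matrix.smul_apply, adjugate_apply, Ring.inverse_eq_inv', smul_eq_mul]
  refine (measurable_det hA).inv.mul (measurable_det fun k l => ?_)
  by_cases hk : k = j
  · subst hk
    simp
  · simpa [updateRow_ne hk] using hA k l

omit [DecidableEq n] in
lemma measurable_dotProduct_mulVec {A : Ω → Matrix n n ℝ} {u v : Ω → n → ℝ}
    (hA : ∀ i j, Measurable fun ω => A ω i j) (hu : ∀ i, Measurable fun ω => u ω i)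
    (hv : ∀ i, Measurable fun ω => v ω i) : Measurable fun ω => u ω ⬝ᵥ A ω *ᵥ v ω := by
  simp only [dotProduct, mulVec]
  exact Finset.measurable_sum _ fun i _ =>
    (hu i).mul (Finset.measurable_sum _ fun j _ => (hA i j).mul (hv j))

end MatrixMeasurability

/-! ### Ville's inequality -/

section Ville

variable {Ω : Type*} {mΩ : MeasurableSpace Ω} {P : Measure Ω}

/-- Ville's inequality for a nonnegative supermartingale over the rounds `1, …, T`. -/
lemma mul_measure_exists_ge_le {F : ℕ → MeasurableSpace Ω} {T : ℕ}
    (hF : ∀ t ∈ Finset.Icc 1 T, F t ≤ mΩ) {M : ℕ → Ω → ℝ≥0∞} (hM : ∀ t ∈ Finset.Icc 1 T, ∀ s ∈ Finset.Icc 1 t, Measurable[F t] (M s))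
    (h1 : ∫⁻ ω, M 1 ω ∂P ≤ 1)
    (hstep : ∀ t, 1 ≤ t → t + 1 ≤ T → ∀ A, MeasurableSet[F t] A →
      ∫⁻ ω in A, M (t + 1) ω ∂P ≤ ∫⁻ ω in A, M t ω ∂P) (C : ℝ≥0∞) :
    C * P {ω | ∃ t ∈ Finset.Icc 1 T, C ≤ M t ω} ≤ 1 := by
  have hmeas : ∀ t ∈ Finset.Icc 1 T, Measurable (M t) := fun t ht =>
    (hM t ht t (by simp at ht ⊢; omega)).mono (hF t ht) le_rfl
  have hD : ∀ t ∈ Finset.Icc 1 T, MeasurableSet {ω | C ≤ M t ω} := fun t ht =>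
    measurableSet_le measurable_const (hmeas t ht)
  have hge : ∀ t ∈ Finset.Icc 1 T, ∀ A : Set Ω, MeasurableSet A → C * P (A ∩ {ω | C ≤ M t ω}) ≤
      ∫⁻ ω in A ∩ {ω | C ≤ M t ω}, M t ω ∂P := by
    intro t ht A hA
    rw [← setLIntegral_const]
    exact setLIntegral_mono' (hA.inter (hD t ht)) fun ω hω => hω.2
  have hB : ∀ t ∈ Finset.Icc 1 T, MeasurableSet[F t] {ω | ∃ s ∈ Finset.Icc 1 t, C ≤ M s ω} := by
    intro t ht
    have : {ω | ∃ s ∈ Finset.Icc 1 t, C ≤ M s ω} = ⋃ s ∈ Finset.Icc 1 t, {ω | C ≤ M s ω} := by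
      ext; simp
    rw [this]
    exact MeasurableSet.biUnion (Finset.countable_toSet _) fun s hs =>
      hM t ht s hs measurableSet_Ici
  rcases Nat.eq_zero_or_pos T with rfl | hT
  · simp
  -- This sum bounds below the mean of the process stopped at its first passage above C. In the
  -- step, only the part that has not yet crossed evolves, and fresh crossings are paid for by
  -- M_{t+1} ≥ C.
  have key : ∀ t, 1 ≤ t → t ≤ T → C * P {ω | ∃ s ∈ Finset.Icc 1 t, C ≤ M s ω} +
      ∫⁻ ω in {ω | ∃ s ∈ Finset.Icc 1 t, C ≤ M s ω}ᶜ, M t ω ∂P ≤ 1 := by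
    intro t ht1
    induction t, ht1 using Nat.le_induction with
    | base =>
      intro htT
      have hs : {ω | ∃ s ∈ Finset.Icc 1 1, C ≤ M s ω} = {ω | C ≤ M 1 ω} := by ext; simp
      rw [hs]
      have h := hge 1 (by simp; omega) Set.univ MeasurableSet.univ
      simp only [Set.univ_inter] at h
      calc _ ≤ ∫⁻ ω in {ω | C ≤ M 1 ω}, M 1 ω ∂P + ∫⁻ ω in {ω | C ≤ M 1 ω}ᶜ, M 1 ω ∂P := by gcongr
        _ = ∫⁻ ω, M 1 ω ∂P := lintegral_add_compl _ (hD 1 (by simp; omega))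
        _ ≤ 1 := h1
    | succ t ht1 ih =>
      intro htT
      have ht : t ∈ Finset.Icc 1 T := by simp; omega
      have ht' : t + 1 ∈ Finset.Icc 1 T := by simp; omega
      have hBt := hB t ht
      set B := {ω | ∃ s ∈ Finset.Icc 1 t, C ≤ M s ω} with hBdef
      set D := {ω | C ≤ M (t + 1) ω} with hDdef
      have hBD : {ω | ∃ s ∈ Finset.Icc 1 (t + 1), C ≤ M s ω} = B ∪ (Bᶜ ∩ D) := by
        rw [Set.union_inter_distrib_left, Set.union_compl_self, Set.univ_inter]
        ext ω
        simp only [Set.mem_ofPred_eq, Set.mem_union, hBdef, hDdef, Finset.mem_Icc]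
        constructor
        · rintro ⟨s, hs, h⟩
          rcases Nat.lt_or_ge t s with hlt | hle
          · obtain rfl : s = t + 1 := by omega
            exact Or.inr h
          · exact Or.inl ⟨s, by omega, h⟩
        · rintro (⟨s, hs, h⟩ | h)
          · exact ⟨s, by omega, h⟩
          · exact ⟨t + 1, by omega, h⟩
      have hcompl : (B ∪ (Bᶜ ∩ D))ᶜ = Bᶜ \ D := by
        ext ω; simp only [Set.mem_compl_iff, Set.mem_union, Set.mem_inter_iff, Set.mem_sdiff]; tauto
      rw [hBD, hcompl]
      calc _ ≤ C * (P B + P (Bᶜ ∩ D)) + ∫⁻ ω in Bᶜ \ D, M (t + 1) ω ∂P := by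
            gcongr; exact measure_union_le _ _
        _ ≤ C * P B + (∫⁻ ω in Bᶜ ∩ D, M (t + 1) ω ∂P + ∫⁻ ω in Bᶜ \ D, M (t + 1) ω ∂P) := by
            rw [mul_add, add_assoc]
            gcongr
            exact hge (t + 1) ht' Bᶜ (hF t ht _ hBt).compl
        _ = C * P B + ∫⁻ ω in Bᶜ, M (t + 1) ω ∂P := by
            rw [lintegral_inter_add_sdiff _ _ (hD _ ht')]
        _ ≤ C * P B + ∫⁻ ω in Bᶜ, M t ω ∂P := by
            gcongr 1
            exact hstep t ht1 htT _ hBt.compl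
        _ ≤ 1 := ih (by omega)
  exact le_trans le_self_add (key T hT le_rfl)

end Ville

/-! ### The mixture process -/

section SelfNormalized

variable {d : ℕ} {lam : ℝ}

/-- The self-normalized process of the method of mixtures. -/
def mixtureFactor (lam : ℝ) (x : ℕ → Vec d) (e : ℕ → ℝ) (t : ℕ) : ℝ :=
  Real.sqrt (lam ^ d / (designMatrix lam x t).det) *
    Real.exp (((noiseSum x e t).ofLp ⬝ᵥ (designMatrix lam x t)⁻¹ *ᵥ (noiseSum x e t).ofLp) / 2)

lemma mixtureFactor_one (hlam : 0 < lam) (x : ℕ → Vec d) (e : ℕ → ℝ) :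
    mixtureFactor lam x e 1 = 1 := by
  have : lam ^ d ≠ 0 := by positivity
  simp [mixtureFactor, noiseSum, designMatrix_one, this]

lemma mixtureFactor_pos (hlam : 0 < lam) (x : ℕ → Vec d) (e : ℕ → ℝ) (t : ℕ) :
    0 < mixtureFactor lam x e t := by
  have := (designMatrix_posDef hlam x t).det_pos
  rw [mixtureFactor]
  positivity

/-- The new factor has the form of `lintegral_exp_gaussianReal` with c = xᵀV⁻¹S_t and r² = xᵀV⁻¹x,
both determined before the noise of round t. -/
lemma mixtureFactor_succ (hlam : 0 < lam) (x : ℕ → Vec d) (e : ℕ → ℝ) {t : ℕ} (ht : 1 ≤ t) :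
    mixtureFactor lam x e (t + 1) = mixtureFactor lam x e t *
      ((Real.sqrt (1 + (x t).ofLp ⬝ᵥ (designMatrix lam x t)⁻¹ *ᵥ (x t).ofLp))⁻¹ *
        Real.exp ((2 * e t * ((x t).ofLp ⬝ᵥ (designMatrix lam x t)⁻¹ *ᵥ (noiseSum x e t).ofLp) +
          e t ^ 2 * ((x t).ofLp ⬝ᵥ (designMatrix lam x t)⁻¹ *ᵥ (x t).ofLp) -
          ((x t).ofLp ⬝ᵥ (designMatrix lam x t)⁻¹ *ᵥ (noiseSum x e t).ofLp) ^ 2) /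
          (2 * (1 + (x t).ofLp ⬝ᵥ (designMatrix lam x t)⁻¹ *ᵥ (x t).ofLp)))) := by
  have hV := designMatrix_posDef hlam x t
  have hdet := hV.det_pos
  have hS : (noiseSum x e (t + 1)).ofLp = (noiseSum x e t).ofLp + e t • (x t).ofLp := by
    rw [noiseSum, Finset.sum_Ico_succ_top ht]; rfl
  have hq := PosDef.dotProduct_mulVec_self_nonneg hV.inv (x t).ofLp
  rw [mixtureFactor, mixtureFactor, designMatrix_succ x ht, hS,
    PosDef.dotProduct_inv_add_vecMulVec_mulVec hV, PosDef.det_add_vecMulVec hV, ← div_div,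
    Real.sqrt_div (by positivity) (1 + _), add_div, Real.exp_add, div_div, mul_comm (1 + _) (2 : ℝ)]
  ring

lemma log_mixtureFactor (hlam : 0 < lam) (x : ℕ → Vec d) (e : ℕ → ℝ) (t : ℕ) :
    2 * Real.log (mixtureFactor lam x e t) =
      weightedNorm (designMatrix lam x t)⁻¹ (noiseSum x e t) ^ 2 -
        (Real.log (designMatrix lam x t).det - d * Real.log lam) := by
  have hV := designMatrix_posDef hlam x t
  have hdet := hV.det_pos
  rw [mixtureFactor, Real.log_mul (by positivity) (by positivity), Real.log_exp,
    Real.log_sqrt (by positivity), Real.log_div (by positivity) hdet.ne', Real.log_pow,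
    weightedNorm_sq hV.inv]
  ring

lemma weightedNorm_noiseSum_le (hd : 2 ≤ d) (hlam : 0 < lam) {x : ℕ → Vec d} {e : ℕ → ℝ} {t : ℕ}
    (ht : 1 ≤ t) (hx : ∀ k ∈ Finset.Ico 1 t, ‖x k‖ ≤ 1) {p : ℝ} (hp : 0 < p) (hp1 : p ≤ 1)
    (h : mixtureFactor lam x e t < p⁻¹) :
    weightedNorm (designMatrix lam x t)⁻¹ (noiseSum x e t) ≤
      Real.sqrt (d * Real.log ((1 + ((t : ℝ) - 1) / lam) / p)) := by
  have hd2 : (2 : ℝ) ≤ d := by exact_mod_cast hd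
  have hcast : ((t - 1 : ℕ) : ℝ) = (t : ℝ) - 1 := by simp [Nat.cast_sub ht]
  have ht1 : (0 : ℝ) ≤ (t : ℝ) - 1 := by rw [← hcast]; positivity
  apply Real.le_sqrt_of_sq_le
  have h1 := Real.log_lt_log (mixtureFactor_pos hlam x e t) h
  have h2 := log_mixtureFactor hlam x e t
  have h3 := log_det_designMatrix_le (by omega) hlam x t hx
  rw [hcast] at h3
  have h4 : Real.log (1 + ((t : ℝ) - 1) / (lam * d)) ≤ Real.log (1 + ((t : ℝ) - 1) / lam) := by
    apply Real.log_le_log (by positivity)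
    gcongr
    nlinarith
  rw [Real.log_div (by positivity) hp.ne']
  rw [Real.log_inv] at h1
  -- The threshold contributes 2 log p⁻¹, which d ≥ 2 and p ≤ 1 allow to be absorbed into d log p⁻¹.
  have h5 := Real.log_nonpos hp.le hp1
  nlinarith

end SelfNormalized

/-! ### Self-normalized concentration -/

section Confidence

variable {Ω : Type*} {d : ℕ}

lemma measurable_action_of_history {x : ℕ → Ω → Vec d} {e : ℕ → Ω → ℝ} {t k : ℕ}
    (hk : k ∈ Finset.Icc 1 t) : Measurable[history x e t] (x k) := by
  rw [measurable_iff_comap_le]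
  exact le_sup_of_le_left (le_iSup₂ (f := fun k (_ : k ∈ Finset.Icc 1 t) =>
    MeasurableSpace.comap (x k) inferInstance) k hk)

lemma measurable_noise_of_history {x : ℕ → Ω → Vec d} {e : ℕ → Ω → ℝ} {t k : ℕ}
    (hk : k ∈ Finset.Ico 1 t) : Measurable[history x e t] (e k) := by
  rw [measurable_iff_comap_le]
  exact le_sup_of_le_right (le_iSup₂ (f := fun k (_ : k ∈ Finset.Ico 1 t) =>
    MeasurableSpace.comap (e k) inferInstance) k hk)

lemma history_le [mΩ : MeasurableSpace Ω] {x : ℕ → Ω → Vec d} {e : ℕ → Ω → ℝ} {T t : ℕ}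
    (hx : ∀ t ∈ Finset.Icc 1 T, Measurable (x t)) (he : ∀ t ∈ Finset.Icc 1 T, Measurable (e t))
    (ht : t ≤ T) : history x e t ≤ mΩ := by
  refine sup_le (iSup₂_le fun k hk => ?_) (iSup₂_le fun k hk => ?_)
  · exact (hx k (by simp at hk ⊢; omega)).comap_le
  · exact (he k (by simp at hk ⊢; omega)).comap_le

section Measurability

variable [MeasurableSpace Ω] {lam : ℝ} {x : ℕ → Ω → Vec d} {e : ℕ → Ω → ℝ} {t : ℕ}

lemma measurable_coord {u : Ω → Vec d} (hu : Measurable u) (i : Fin d) :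
    Measurable fun ω => (u ω).ofLp i :=
  (PiLp.continuous_apply 2 _ i).measurable.comp hu

lemma measurable_designMatrix_apply (hx : ∀ k ∈ Finset.Ico 1 t, Measurable (x k)) (i j : Fin d) :
    Measurable fun ω => designMatrix lam (fun t => x t ω) t i j := by
  simp only [designMatrix, Matrix.add_apply, Matrix.sum_apply, vecMulVec_apply]
  exact (Finset.measurable_sum _ fun k hk =>
    (measurable_coord (hx k hk) i).mul (measurable_coord (hx k hk) j)).add_const _

lemma measurable_noiseSum (hx : ∀ k ∈ Finset.Ico 1 t, Measurable (x k))
    (he : ∀ k ∈ Finset.Ico 1 t, Measurable (e k)) :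
    Measurable fun ω => noiseSum (fun t => x t ω) (fun t => e t ω) t :=
  Finset.measurable_sum _ fun k hk => (he k hk).smul (hx k hk)

lemma measurable_mixtureFactor (hx : ∀ k ∈ Finset.Ico 1 t, Measurable (x k))
    (he : ∀ k ∈ Finset.Ico 1 t, Measurable (e k)) :
    Measurable fun ω => mixtureFactor lam (fun t => x t ω) (fun t => e t ω) t := by
  have hA := measurable_designMatrix_apply (lam := lam) hx
  have hS := measurable_coord (measurable_noiseSum hx he)
  have h1 := measurable_det hA
  have h2 := measurable_dotProduct_mulVec (measurable_inv_apply hA) hS hS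
  exact (h1.const_div _).sqrt.mul (h2.div_const 2).exp

end Measurability

variable [mΩ : MeasurableSpace Ω] {P : Measure Ω} [IsProbabilityMeasure P] {lam rho : ℝ} {T : ℕ}
  {x : ℕ → Ω → Vec d} {e : ℕ → Ω → ℝ}

/-- Ville's inequality for the mixture process, which starts at 1. The σ-algebras are left abstract
so that the history of the original noise can serve for the rescaled one. -/
lemma measure_exists_mixtureFactor_ge_le (hlam : 0 < lam)
    (he : ∀ t ∈ Finset.Icc 1 T, Measurable (e t)) {F : ℕ → MeasurableSpace Ω}
    (hF : ∀ t ∈ Finset.Icc 1 T, F t ≤ mΩ)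
    (hFx : ∀ t ∈ Finset.Icc 1 T, ∀ k ∈ Finset.Icc 1 t, Measurable[F t] (x k))
    (hFe : ∀ t ∈ Finset.Icc 1 T, ∀ k ∈ Finset.Ico 1 t, Measurable[F t] (e k))
    (hsub : ∀ t ∈ Finset.Icc 1 T, SubgaussianGiven (F t) P (e t)) {p : ℝ} (hp : 0 < p) :
    P {ω | ∃ t ∈ Finset.Icc 1 T, p⁻¹ ≤ mixtureFactor lam (fun t => x t ω) (fun t => e t ω) t} ≤
      ENNReal.ofReal p := by
  set M : ℕ → Ω → ℝ≥0∞ := fun t ω =>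
    ENNReal.ofReal (mixtureFactor lam (fun t => x t ω) (fun t => e t ω) t) with hMdef
  have hM : ∀ t ∈ Finset.Icc 1 T, ∀ s ∈ Finset.Icc 1 t, Measurable[F t] (M s) := by
    intro t ht s hs
    refine ENNReal.measurable_ofReal.comp (@measurable_mixtureFactor _ _ (F t) _ _ _ _ ?_ ?_)
    · exact fun k hk => hFx t ht k (by simp at hk hs ⊢; omega)
    · exact fun k hk => hFe t ht k (by simp at hk hs ⊢; omega)
  have h := mul_measure_exists_ge_le hF hM (P := P) (by simp [hMdef, mixtureFactor_one hlam])
    ?_ (ENNReal.ofReal p⁻¹)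
  · have hset : {ω | ∃ t ∈ Finset.Icc 1 T, ENNReal.ofReal p⁻¹ ≤ M t ω} = {ω | ∃ t ∈ Finset.Icc 1 T,
        p⁻¹ ≤ mixtureFactor lam (fun t => x t ω) (fun t => e t ω) t} := by
      ext ω
      simp only [Set.mem_ofPred_eq, hMdef]
      refine exists_congr fun t => and_congr_right fun _ => ?_
      exact ENNReal.ofReal_le_ofReal_iff (mixtureFactor_pos hlam _ _ t).le
    rw [hset, ENNReal.ofReal_inv_of_pos hp] at h
    rw [mul_comm, ← div_eq_mul_inv] at h
    simpa using ENNReal.div_le_iff_le_mul (by simp [hp]) (by simp) |>.1 h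
  · intro t ht1 htT A hA
    have ht : t ∈ Finset.Icc 1 T := by simp; omega
    have hA' := hF t ht A hA
    have hxI : ∀ k ∈ Finset.Ico 1 t, Measurable[F t] (x k) := fun k hk =>
      hFx t ht k (by simp at hk ⊢; omega)
    have hxt := hFx t ht t (by simp; omega)
    have hinv := @measurable_inv_apply _ (F t) _ _ _ _
      (@measurable_designMatrix_apply _ _ (F t) lam _ _ hxI)
    have hX := @measurable_coord _ _ (F t) _ hxt
    have hS := @measurable_coord _ _ (F t) _ (@measurable_noiseSum _ _ (F t) _ _ _ hxI (hFe t ht))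
    have hq := @measurable_dotProduct_mulVec _ (F t) _ _ _ _ _ hinv hX hX
    have hc := @measurable_dotProduct_mulVec _ (F t) _ _ _ _ _ hinv hX hS
    -- The weight 1_A M_t is known before the noise of round t, since M_t involves only noise of
    -- rounds k < t.
    have hmix := (hsub t ht).lintegral_mixture_le (hF t ht) (he t ht) hc hq
      (fun ω => PosDef.dotProduct_mulVec_self_nonneg (designMatrix_posDef hlam _ t).inv _)
      (W := A.indicator (M t)) ((hM t ht t (by simp; omega)).indicator hA)
      (fun ω => by by_cases h : ω ∈ A <;> simp [h, hMdef])
    rw [← lintegral_indicator hA', ← lintegral_indicator hA']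
    refine le_of_eq_of_le (lintegral_congr fun ω => ?_) hmix
    by_cases h : ω ∈ A
    · simp only [Set.indicator_of_mem h, hMdef]
      rw [← ENNReal.ofReal_mul (mixtureFactor_pos hlam _ _ t).le, mixtureFactor_succ hlam _ _ ht1]
    · simp [h]

/-- Taking s = ±1 shows that exp(e) + exp(-e) - 2 has integral at most 0, yet it is nonnegative and
vanishes only at e = 0. -/
lemma noise_ae_eq_zero (hx : ∀ t ∈ Finset.Icc 1 T, Measurable (x t))
    (he : ∀ t ∈ Finset.Icc 1 T, Measurable (e t)) (h : IsCondSubgaussianNoise P 0 T x e) {t : ℕ}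
    (ht : t ∈ Finset.Icc 1 T) : e t =ᵐ[P] 0 := by
  obtain ⟨-, -, hexp⟩ := h t ht
  have hm := history_le hx he (Finset.mem_Icc.1 ht).2
  have hint : ∀ s : ℝ, ∫ ω, Real.exp (s * e t ω) ∂P ≤ 1 := by
    intro s
    rw [← integral_condExp hm]
    calc _ ≤ ∫ _, Real.exp (s ^ 2 * 0 ^ 2 / 2) ∂P :=
          integral_mono_ae integrable_condExp (integrable_const _) (hexp s).2
      _ = 1 := by simp
  have hi := ((hexp 1).1.add (hexp (-1)).1).sub (integrable_const 2)
  have hgt : ∀ r : ℝ, r ≠ 0 → 0 < Real.exp (1 * r) + Real.exp (-1 * r) - 2 := by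
    intro r hr
    have h1 := Real.add_one_lt_exp hr
    have h2 := Real.add_one_lt_exp (neg_ne_zero.2 hr)
    simp only [one_mul, neg_mul]
    linarith
  have hnn : ∀ r : ℝ, 0 ≤ Real.exp (1 * r) + Real.exp (-1 * r) - 2 := by
    intro r
    rcases eq_or_ne r 0 with rfl | hr
    · norm_num
    · exact (hgt r hr).le
  have hzero : ∫ ω, Real.exp (1 * e t ω) + Real.exp (-1 * e t ω) - 2 ∂P = 0 := by
    apply le_antisymm _ (integral_nonneg fun ω => hnn _)
    rw [integral_sub (f := fun ω => Real.exp (1 * e t ω) + Real.exp (-1 * e t ω))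
        ((hexp 1).1.add (hexp (-1)).1) (integrable_const 2),
      integral_add (hexp 1).1 (hexp (-1)).1]
    have h1 := hint 1
    have h2 := hint (-1)
    simp only [integral_const, probReal_univ, smul_eq_mul]
    linarith
  have := (integral_eq_zero_iff_of_nonneg (fun ω => hnn (e t ω)) hi).1 hzero
  filter_upwards [this] with ω hω
  by_contra hne
  exact (hgt _ hne).ne' hω

lemma IsCondSubgaussianNoise.subgaussianGiven (hrho : 0 < rho)
    (hx : ∀ t ∈ Finset.Icc 1 T, Measurable (x t)) (he : ∀ t ∈ Finset.Icc 1 T, Measurable (e t))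
    (h : IsCondSubgaussianNoise P rho T x e) {t : ℕ} (ht : t ∈ Finset.Icc 1 T) :
    SubgaussianGiven (history x e t) P (fun ω => rho⁻¹ * e t ω) := by
  intro s W hW
  obtain ⟨-, -, hexp⟩ := h t ht
  have het := he t ht
  have key := lintegral_mul_ofReal_le_of_condExp_le (history_le hx he (Finset.mem_Icc.1 ht).2)
    (by fun_prop) (fun ω => (Real.exp_pos _).le) (hexp (s * rho⁻¹)).1 (hexp (s * rho⁻¹)).2 hW
  have hs : (s * rho⁻¹) ^ 2 * rho ^ 2 / 2 = s ^ 2 / 2 := by field_simp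
  rw [hs] at key
  have hW' : Measurable W := hW.mono (history_le hx he (Finset.mem_Icc.1 ht).2) le_rfl
  calc _ = ∫⁻ ω, ENNReal.ofReal (Real.exp (-(s ^ 2 / 2))) *
          (W ω * ENNReal.ofReal (Real.exp (s * rho⁻¹ * e t ω))) ∂P := by
        refine lintegral_congr fun ω => ?_
        rw [sub_eq_add_neg, Real.exp_add, ENNReal.ofReal_mul (Real.exp_pos _).le, mul_assoc s]
        ring
    _ = ENNReal.ofReal (Real.exp (-(s ^ 2 / 2))) *
          ∫⁻ ω, W ω * ENNReal.ofReal (Real.exp (s * rho⁻¹ * e t ω)) ∂P :=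
        lintegral_const_mul _ (by fun_prop)
    _ ≤ ENNReal.ofReal (Real.exp (-(s ^ 2 / 2))) *
          (ENNReal.ofReal (Real.exp (s ^ 2 / 2)) * ∫⁻ ω, W ω ∂P) := by gcongr
    _ = _ := by
        rw [← mul_assoc, ← ENNReal.ofReal_mul (Real.exp_pos _).le, ← Real.exp_add]
        simp

/-- The self-normalized concentration inequality, uniformly over the rounds `1, …, T`. -/
lemma measure_exists_weightedNorm_noiseSum_gt_le (hd : 2 ≤ d) (hlam : 0 < lam) (hrho : 0 ≤ rho)
    (hx : ∀ t ∈ Finset.Icc 1 T, Measurable (x t)) (he : ∀ t ∈ Finset.Icc 1 T, Measurable (e t))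
    (hball : ∀ᵐ ω ∂P, ∀ t ∈ Finset.Icc 1 T, ‖x t ω‖ ≤ 1)
    (h : IsCondSubgaussianNoise P rho T x e) {p : ℝ} (hp : 0 < p) (hp1 : p ≤ 1) :
    P {ω | ∃ t ∈ Finset.Icc 1 T,
      rho * Real.sqrt (d * Real.log ((1 + ((t : ℝ) - 1) / lam) / p)) <
        weightedNorm (designMatrix lam (fun t => x t ω) t)⁻¹
          (noiseSum (fun t => x t ω) (fun t => e t ω) t)} ≤ ENNReal.ofReal p := by
  -- Noise is normalized by ρ⁻¹, so ρ = 0 is separate: there the noise vanishes almost surely.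
  rcases hrho.eq_or_lt with rfl | hrho
  · have hz : ∀ᵐ ω ∂P, ∀ t ∈ Finset.Icc 1 T, e t ω = 0 :=
      (ae_ball_iff (Finset.countable_toSet _)).2 fun t ht => noise_ae_eq_zero hx he h ht
    refine le_of_eq_of_le (measure_mono_null (fun ω hω => ?_) (ae_iff.1 hz)) zero_le
    intro hω0
    obtain ⟨t, ht, hlt⟩ := hω
    have : noiseSum (fun t => x t ω) (fun t => e t ω) t = 0 :=
      Finset.sum_eq_zero fun k hk => by
        simp [hω0 k (by simp at hk ht ⊢; omega)]
    rw [this] at hlt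
    simp [weightedNorm] at hlt
  · refine le_trans (measure_mono_ae ?_) (measure_exists_mixtureFactor_ge_le (p := p) hlam (x := x)
      (e := fun t ω => rho⁻¹ * e t ω) (fun t ht => (he t ht).const_mul _) (F := history x e)
      (fun t ht => history_le hx he (Finset.mem_Icc.1 ht).2)
      (fun t ht k hk => measurable_action_of_history hk)
      (fun t ht k hk => (measurable_noise_of_history hk).const_mul _)
      (fun t ht => h.subgaussianGiven hrho hx he ht) hp)
    filter_upwards [hball] with ω hω
    rintro ⟨t, ht, hlt⟩
    refine ⟨t, ht, ?_⟩
    by_contra! hcon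
    have ht' := Finset.mem_Icc.1 ht
    have hle := weightedNorm_noiseSum_le hd hlam ht'.1
      (fun k hk => hω k (by simp at hk ⊢; omega)) hp hp1 hcon
    have hscale : noiseSum (fun t => x t ω) (fun t => e t ω) t =
        rho • noiseSum (fun t => x t ω) (fun t => rho⁻¹ * e t ω) t := by
      simp only [noiseSum, Finset.smul_sum, smul_smul]
      refine Finset.sum_congr rfl fun k _ => ?_
      rw [mul_inv_cancel_left₀ hrho.ne']
    rw [hscale, weightedNorm_smul _ hrho.le] at hlt
    exact absurd hlt (not_lt.2 (by gcongr))

end Confidence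

end SafeBandit
end

noncomputable section

namespace SafeBandit

open scoped ENNReal

/-! ### Instantaneous regret and counting of wrong directions -/

section Regret

variable {d : ℕ} {I : Input d}

lemma Input.beta_nonneg (hrho : 0 ≤ I.rho) (hS : 0 ≤ I.S) (t : ℕ) : 0 ≤ I.beta t := by
  rw [Input.beta]
  positivity

lemma Input.beta_mono (hrho : 0 ≤ I.rho) (hdelta : 0 < I.delta) (hlam : 0 < I.lam) {s t : ℕ}
    (hs : 1 ≤ s) (hst : s ≤ t) : I.beta s ≤ I.beta t := by
  have h1 : (1 : ℝ) ≤ s := by exact_mod_cast hs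
  have h2 : (s : ℝ) ≤ t := by exact_mod_cast hst
  have h3 : 0 ≤ ((s : ℝ) - 1) / I.lam := div_nonneg (by linarith) hlam.le
  unfold Input.beta
  gcongr

lemma Input.width_smul (x : ℕ → Vec d) (t : ℕ) {r : ℝ} (hr : 0 ≤ r) (v : Vec d) :
    I.width x t (r • v) = r * I.width x t v := by
  rw [Input.width, Input.width, weightedNorm_smul _ hr]
  ring

lemma Input.abs_inner_leastSquares_sub_le_width (hlam : 0 < I.lam) {x : ℕ → Vec d} {e : ℕ → ℝ}
    {theta : Vec d} (htheta : ‖theta‖ ≤ I.S) {t : ℕ}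
    (h : weightedNorm (designMatrix I.lam x t)⁻¹ (noiseSum x e t) ≤
      I.rho * Real.sqrt (d * Real.log ((1 + ((t : ℝ) - 1) / I.lam) / (I.delta / 2))))
    (v : Vec d) :
    |inner ℝ (leastSquares I.lam x (fun k => inner ℝ theta (x k) + e k) t) v - inner ℝ theta v| ≤
      I.width x t v := by
  refine (abs_inner_leastSquares_sub_le hlam x e theta t v).trans ?_
  have := weightedNorm_nonneg (designMatrix I.lam x t)⁻¹ v
  unfold Input.width Input.beta
  gcongr

lemma Input.IsROFULRound.mem_actions (hstar : StarConvex ℝ 0 I.actions)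
    {x : ℕ → Vec d} {y z : ℕ → ℝ} {t : ℕ} (h : I.IsROFULRound x y z t) : x t ∈ I.actions := by
  obtain ⟨xopt, mu, hxo, -, ⟨⟨⟨hmu0, hmu1⟩, -⟩, -⟩, hxt⟩ := h
  rw [hxt]
  exact hstar.smul_mem hxo.1 (hmu0.trans (le_max_right _ _)) (max_le (min_le_right _ _) hmu1)

variable {theta a xstar : Vec d} {x : ℕ → Vec d} {y z : ℕ → ℝ} {t : ℕ}

/-- If the first term of γ is the maximum, the action has norm at most ν and aᵀx ≤ S_a ν = b;
otherwise it lies in the pessimistic set. -/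
lemma Input.IsROFULRound.mem_feasibleSet (hstar : StarConvex ℝ 0 I.actions) (hSa : 0 < I.Sa)
    (ha : ‖a‖ ≤ I.Sa) (hb : 0 < I.b) (h : I.IsROFULRound x y z t)
    (hconf : ∀ v, |inner ℝ (leastSquares I.lam x z t) v - inner ℝ a v| ≤ I.width x t v) :
    x t ∈ I.feasibleSet a := by
  have hnu : 0 < I.nu := div_pos hb hSa
  refine ⟨h.mem_actions hstar, ?_⟩
  obtain ⟨xopt, mu, hxo, -, ⟨⟨⟨hmu0, hmu1⟩, hmup⟩, -⟩, hxt⟩ := h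
  rcases max_choice (min (I.nu / ‖xopt‖) 1) mu with hmax | hmax
  · rw [hxt, hmax]
    have hg0 : 0 ≤ min (I.nu / ‖xopt‖) 1 := by positivity
    have hn : min (I.nu / ‖xopt‖) 1 * ‖xopt‖ ≤ I.nu := by
      rcases (norm_nonneg xopt).eq_or_lt with h0 | h0
      · rw [← h0, mul_zero]; exact hnu.le
      · exact (le_div_iff₀ h0).1 (min_le_left _ _)
    calc _ ≤ ‖a‖ * ‖min (I.nu / ‖xopt‖) 1 • xopt‖ := real_inner_le_norm _ _
      _ ≤ I.Sa * I.nu := by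
        rw [norm_smul, Real.norm_of_nonneg hg0]
        gcongr
      _ = I.b := by rw [Input.nu]; field_simp
  · rw [hxt, hmax]
    have h1 := (abs_le.1 (hconf (mu • xopt))).1
    have h2 := hmup.2
    linarith

/-- The instantaneous regret of ROFUL is controlled by the confidence width of the action. -/
lemma Input.IsROFULRound.inner_sub_le (hstar : StarConvex ℝ 0 I.actions)
    (hball : ∀ v ∈ I.actions, ‖v‖ ≤ 1) (hb : 0 < I.b) (hbS : I.b ≤ I.S) (hrho : 0 ≤ I.rho)
    (htheta : ‖theta‖ ≤ I.S) (hxstar : xstar ∈ I.feasibleSet a) (hpos : 0 < inner ℝ theta xstar)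
    (h : I.IsROFULRound x y z t)
    (hconfy : ∀ v, |inner ℝ (leastSquares I.lam x y t) v - inner ℝ theta v| ≤ I.width x t v)
    (hconfz : ∀ v, |inner ℝ (leastSquares I.lam x z t) v - inner ℝ a v| ≤ I.width x t v) :
    inner ℝ theta (xstar - x t) ≤ 4 * I.S / I.b * I.width x t (x t) := by
  obtain ⟨xopt, mu, hxo, hmax, ⟨⟨⟨hmu0, hmu1⟩, hmup⟩, hub⟩, hxt⟩ := h
  set g := max (min (I.nu / ‖xopt‖) 1) mu
  have hgmu : mu ≤ g := le_max_right _ _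
  have hg0 : 0 ≤ g := hmu0.trans hgmu
  have hw0 : 0 ≤ I.width x t xopt :=
    mul_nonneg (I.beta_nonneg hrho (hb.le.trans hbS) t) (weightedNorm_nonneg _ _)
  have hwx : I.width x t (x t) = g * I.width x t xopt := by rw [hxt, I.width_smul x t hg0]
  rw [hwx]
  set w := I.width x t xopt with hw
  have hxs : xstar ∈ I.optimisticSet x z t := by
    refine ⟨hxstar.1, ?_⟩
    have h1 := (abs_le.1 (hconfz xstar)).2
    have h2 := hxstar.2
    linarith
  have hucb : inner ℝ theta xstar ≤ inner ℝ theta xopt + 2 * w := by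
    have h1 : I.ucb x y t xstar ≤ I.ucb x y t xopt := hmax hxs
    rw [Input.ucb, Input.ucb, ← hw] at h1
    have h2 := (abs_le.1 (hconfy xstar)).1
    have h3 := (abs_le.1 (hconfy xopt)).2
    rw [← hw] at h3
    linarith
  -- Optimistic feasibility gives âᵀx̃ + w ≤ b + 2w, so scaling by b/(b + 2w) lands in the
  -- pessimistic set; maximality of μ then bounds γ from below.
  have hpess : I.b ≤ g * (I.b + 2 * w) := by
    have hpos' : 0 < I.b + 2 * w := by positivity
    have hm0 : 0 ≤ I.b / (I.b + 2 * w) := by positivity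
    have hm1 : I.b / (I.b + 2 * w) ≤ 1 := by rw [div_le_one hpos']; linarith
    rw [← div_le_iff₀ hpos']
    refine (hub ⟨⟨hm0, hm1⟩, hstar.smul_mem hxo.1 hm0 hm1, ?_⟩).trans hgmu
    rw [I.width_smul x t hm0, inner_smul_right, ← hw, ← mul_add]
    have h1 := hxo.2
    rw [← hw] at h1
    calc _ ≤ I.b / (I.b + 2 * w) * (I.b + 2 * w) :=
          mul_le_mul_of_nonneg_left (by linarith) hm0
      _ = I.b := div_mul_cancel₀ _ hpos'.ne'
  have hL : inner ℝ theta xstar ≤ I.S := by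
    have h1 := real_inner_le_norm theta xstar
    have h2 := hball xstar hxstar.1
    have h3 := norm_nonneg theta
    nlinarith
  rw [inner_sub_right, hxt, inner_smul_right]
  have hu : 0 ≤ g * w := mul_nonneg hg0 hw0
  -- Times b, the regret is at most b(1 - γ)θᵀx_* + 2γwb. Each term is at most 2γwS, by b(1 - γ) ≤
  -- 2γw, θᵀx_* ≤ S and b ≤ S.
  rw [div_mul_eq_mul_div, le_div_iff₀ hb]
  have h1 := mul_le_mul_of_nonneg_left hucb hg0
  have h2 : I.b * (1 - g) * inner ℝ theta xstar ≤ 2 * (g * w) * inner ℝ theta xstar :=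
    mul_le_mul_of_nonneg_right (by linarith) hpos.le
  have h3 : 2 * (g * w) * inner ℝ theta xstar ≤ 2 * (g * w) * I.S := by gcongr
  have h4 : 2 * (g * w) * I.b ≤ 2 * (g * w) * I.S := by gcongr
  have h5 := mul_le_mul_of_nonneg_right h1 hb.le
  linarith

lemma Input.rewardGap_le (hopt : IsMaxOn (fun v => inner ℝ theta v) (I.feasibleSet a) xstar)
    {v : Vec d} (hv : v ∈ I.feasibleSet a) (hne : ¬ ∃ α : ℝ, 0 < α ∧ v = α • xstar) :
    I.rewardGap theta a xstar ≤ inner ℝ theta (xstar - v) := by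
  -- Optimality of x_* makes 0 a lower bound, as the real infimum requires.
  refine csInf_le ⟨0, ?_⟩ ⟨v, ⟨hv, fun α hα h => hne ⟨α, hα, h⟩⟩, rfl⟩
  rintro _ ⟨u, hu, rfl⟩
  have : inner ℝ theta u ≤ inner ℝ theta xstar := hopt hu.1
  simp only [inner_sub_right]
  linarith

/-- The bound on the number of wrong directions on the event that all confidence bounds hold. -/
lemma Input.wrongDirections_le {T : ℕ} (hd : 0 < d) (hstar : StarConvex ℝ 0 I.actions)
    (hball : ∀ v ∈ I.actions, ‖v‖ ≤ 1) (hSa : 0 < I.Sa) (ha : ‖a‖ ≤ I.Sa)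
    (htheta : ‖theta‖ ≤ I.Stheta) (hb : 0 < I.b) (hnu : I.nu ≤ 1) (hrho : 0 ≤ I.rho)
    (hdelta : 0 < I.delta) (hlam : 1 ≤ I.lam) (hxstar : xstar ∈ I.feasibleSet a)
    (hopt : IsMaxOn (fun v => inner ℝ theta v) (I.feasibleSet a) xstar)
    (hpos : 0 < inner ℝ theta xstar) (hgap : 0 < I.rewardGap theta a xstar)
    (hrun : I.IsROFULRun T x y z)
    (hconfy : ∀ t ∈ Finset.Icc 1 T, ∀ v,
      |inner ℝ (leastSquares I.lam x y t) v - inner ℝ theta v| ≤ I.width x t v)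
    (hconfz : ∀ t ∈ Finset.Icc 1 T, ∀ v,
      |inner ℝ (leastSquares I.lam x z t) v - inner ℝ a v| ≤ I.width x t v) :
    (wrongDirections T x xstar : ℝ) ≤
      32 * I.S ^ 2 * I.beta T ^ 2 * d / (I.b ^ 2 * I.rewardGap theta a xstar ^ 2) *
        Real.log (1 + T / (I.lam * d)) := by
  classical
  have hlam0 : 0 < I.lam := by linarith
  have hbS : I.b ≤ I.S := ((div_le_one hSa).1 hnu).trans (le_max_left _ _)
  have hS : 0 ≤ I.S := hb.le.trans hbS
  have hact : ∀ t ∈ Finset.Icc 1 T, ‖x t‖ ≤ 1 := fun t ht =>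
    hball _ ((hrun t ht).mem_actions hstar)
  set G := I.rewardGap theta a xstar
  set q : ℕ → ℝ := fun t =>
    dotProduct (x t).ofLp ((designMatrix I.lam x t)⁻¹.mulVec (x t).ofLp) with hq
  have hq0 : ∀ t, 0 ≤ q t := fun t =>
    PosDef.dotProduct_mulVec_self_nonneg (designMatrix_posDef hlam0 x t).inv _
  set c := (4 * I.S / I.b) ^ 2 * I.beta T ^ 2 with hc
  have hc0 : 0 ≤ c := by positivity
  have hround : ∀ t ∈ Finset.Icc 1 T, (¬ ∃ α : ℝ, 0 < α ∧ x t = α • xstar) → G ^ 2 ≤ c * q t := by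
    intro t ht hne
    have h1 := I.rewardGap_le hopt
      ((hrun t ht).mem_feasibleSet hstar hSa ha hb (hconfz t ht)) hne
    have h2 := (hrun t ht).inner_sub_le hstar hball hb hbS hrho
      (htheta.trans (le_max_right _ _)) hxstar hpos (hconfy t ht) (hconfz t ht)
    have ht' := Finset.mem_Icc.1 ht
    have h3 := I.beta_mono hrho hdelta hlam0 ht'.1 ht'.2
    have h4 := I.beta_nonneg hrho hS t
    calc G ^ 2 ≤ (4 * I.S / I.b * I.width x t (x t)) ^ 2 := by
          gcongr
          exact h1.trans h2
      _ = (4 * I.S / I.b) ^ 2 * I.beta t ^ 2 * q t := by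
          rw [Input.width, mul_pow, mul_pow,
            weightedNorm_sq (designMatrix_posDef hlam0 x t).inv, mul_assoc]
      _ ≤ c * q t := by
          have := hq0 t
          rw [hc]
          gcongr
  have hsum : (wrongDirections T x xstar : ℝ) * G ^ 2 ≤ c * ∑ t ∈ Finset.Icc 1 T, q t := by
    calc (wrongDirections T x xstar : ℝ) * G ^ 2 =
          ∑ t ∈ (Finset.Icc 1 T).filter (fun t => ¬ ∃ α : ℝ, 0 < α ∧ x t = α • xstar), G ^ 2 := by
          rw [Finset.sum_const, nsmul_eq_mul, wrongDirections]
      _ ≤ ∑ t ∈ (Finset.Icc 1 T).filter (fun t => ¬ ∃ α : ℝ, 0 < α ∧ x t = α • xstar),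
          c * q t := Finset.sum_le_sum fun t ht =>
            hround t (Finset.mem_filter.1 ht).1 (Finset.mem_filter.1 ht).2
      _ ≤ ∑ t ∈ Finset.Icc 1 T, c * q t :=
          Finset.sum_le_sum_of_subset_of_nonneg (Finset.filter_subset _ _)
            fun t _ _ => mul_nonneg hc0 (hq0 t)
      _ = _ := (Finset.mul_sum _ _ _).symm
  have hpot := sum_dotProduct_inv_designMatrix_le hlam x T hact
  have hdet := log_det_designMatrix_le hd hlam0 x (T + 1) fun k hk =>
    hact k (by simp at hk ⊢; omega)
  rw [Nat.add_sub_cancel] at hdet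
  have hfin : (wrongDirections T x xstar : ℝ) * G ^ 2 ≤
      c * (2 * (d * Real.log (1 + T / (I.lam * d)))) :=
    hsum.trans (mul_le_mul_of_nonneg_left (by linarith) hc0)
  rw [← le_div_iff₀ (by positivity)] at hfin
  refine hfin.trans_eq ?_
  rw [hc]
  field_simp
  ring

end Regret

end SafeBandit
end

/-! ### Union bound over the two confidence failures -/

theorem theorem2 {d : ℕ} (hd : 2 ≤ d) (I : SafeBandit.Input d) (theta a xstar : SafeBandit.Vec d) (T : ℕ)
    -- the action set
    (hclosed : IsClosed I.actions) (hstar : StarConvex ℝ 0 I.actions)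
    (hball : ∀ v ∈ I.actions, ‖v‖ ≤ 1)
    -- the parameters
    (hSa : 0 < I.Sa) (hStheta : 0 < I.Stheta) (ha : ‖a‖ ≤ I.Sa) (htheta : ‖theta‖ ≤ I.Stheta)
    (hb : 0 < I.b) (hnu : I.nu ≤ 1) (hrho : 0 ≤ I.rho)
    (hdelta : I.delta ∈ Set.Ioo (0 : ℝ) 1) (hlam : 1 ≤ I.lam)
    -- the optimal action has positive reward
    (hxstar : xstar ∈ I.feasibleSet a)
    (hopt : IsMaxOn (fun v => inner ℝ theta v) (I.feasibleSet a) xstar)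
    (hpos : 0 < inner ℝ theta xstar)
    -- the reward gap is positive
    (hgap : 0 < I.rewardGap theta a xstar)
    -- the actions and the noise
    {Ω : Type*} [MeasurableSpace Ω] (P : MeasureTheory.Measure Ω)
    [MeasureTheory.IsProbabilityMeasure P]
    (x : ℕ → Ω → SafeBandit.Vec d) (eps eta : ℕ → Ω → ℝ)
    (hx : ∀ t ∈ Finset.Icc 1 T, Measurable (x t))
    (heps : ∀ t ∈ Finset.Icc 1 T, Measurable (eps t))
    (heta : ∀ t ∈ Finset.Icc 1 T, Measurable (eta t))
    (hsubeps : SafeBandit.IsCondSubgaussianNoise P I.rho T x eps)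
    (hsubeta : SafeBandit.IsCondSubgaussianNoise P I.rho T x eta)
    -- the actions are those of ROFUL for the rewards `θᵀ x_t + ε_t` and the constraint
    -- observations `aᵀ x_t + η_t`
    (hrun : ∀ᵐ ω ∂P, I.IsROFULRun T (fun t => x t ω)
      (fun t => inner ℝ theta (x t ω) + eps t ω) (fun t => inner ℝ a (x t ω) + eta t ω)) :
    ENNReal.ofReal (1 - I.delta) ≤
      P {ω | (SafeBandit.wrongDirections T (fun t => x t ω) xstar : ℝ) ≤
        32 * I.S ^ 2 * I.beta T ^ 2 * d / (I.b ^ 2 * I.rewardGap theta a xstar ^ 2) *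
          Real.log (1 + T / (I.lam * d))} := by
  have hlam0 : 0 < I.lam := by linarith
  have hdpos : 0 < I.delta := hdelta.1
  have hact : ∀ᵐ ω ∂P, ∀ t ∈ Finset.Icc 1 T, ‖x t ω‖ ≤ 1 := by
    filter_upwards [hrun] with ω hω t ht
    exact hball _ ((hω t ht).mem_actions hstar)
  have hbad := fun (e : ℕ → Ω → ℝ) (he : ∀ t ∈ Finset.Icc 1 T, Measurable (e t))
      (hsub : SafeBandit.IsCondSubgaussianNoise P I.rho T x e) =>
    SafeBandit.measure_exists_weightedNorm_noiseSum_gt_le hd hlam0 hrho hx he hact hsub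
      (half_pos hdpos) (by linarith [hdelta.2])
  have hbadeps := hbad eps heps hsubeps
  have hbadeta := hbad eta heta hsubeta
  set Beps := {ω | ∃ t ∈ Finset.Icc 1 T,
    I.rho * Real.sqrt (d * Real.log ((1 + ((t : ℝ) - 1) / I.lam) / (I.delta / 2))) <
      SafeBandit.weightedNorm (SafeBandit.designMatrix I.lam (fun t => x t ω) t)⁻¹
        (SafeBandit.noiseSum (fun t => x t ω) (fun t => eps t ω) t)}
  set Beta := {ω | ∃ t ∈ Finset.Icc 1 T,
    I.rho * Real.sqrt (d * Real.log ((1 + ((t : ℝ) - 1) / I.lam) / (I.delta / 2))) <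
      SafeBandit.weightedNorm (SafeBandit.designMatrix I.lam (fun t => x t ω) t)⁻¹
        (SafeBandit.noiseSum (fun t => x t ω) (fun t => eta t ω) t)}
  set good := {ω | (SafeBandit.wrongDirections T (fun t => x t ω) xstar : ℝ) ≤
        32 * I.S ^ 2 * I.beta T ^ 2 * d / (I.b ^ 2 * I.rewardGap theta a xstar ^ 2) *
          Real.log (1 + T / (I.lam * d))}
  have hcompl : P goodᶜ ≤ ENNReal.ofReal I.delta := by
    calc P goodᶜ ≤ P (Beps ∪ Beta) := by
          refine measure_mono_ae ?_
          filter_upwards [hrun] with ω hω hng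
          by_contra hcon
          have hcon' : ω ∉ Beps ∧ ω ∉ Beta := not_or.1 hcon
          refine hng (SafeBandit.Input.wrongDirections_le (by omega) hstar hball hSa ha htheta hb
            hnu hrho hdpos hlam hxstar hopt hpos hgap hω (fun t ht => ?_) (fun t ht => ?_))
          · exact I.abs_inner_leastSquares_sub_le_width hlam0 (htheta.trans (le_max_right _ _))
              (not_lt.1 fun hlt => hcon'.1 ⟨t, ht, hlt⟩)
          · exact I.abs_inner_leastSquares_sub_le_width hlam0 (ha.trans (le_max_left _ _))
              (not_lt.1 fun hlt => hcon'.2 ⟨t, ht, hlt⟩)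
      _ ≤ P Beps + P Beta := measure_union_le _ _
      _ ≤ ENNReal.ofReal (I.delta / 2) + ENNReal.ofReal (I.delta / 2) :=
          add_le_add hbadeps hbadeta
      _ = ENNReal.ofReal I.delta := by
          rw [← ENNReal.ofReal_add (by positivity) (by positivity), add_halves]
  rw [ENNReal.ofReal_sub _ hdpos.le, ENNReal.ofReal_one, tsub_le_iff_right]
  -- Subadditivity suffices, so measurability of the good event is not needed.
  calc (1 : ENNReal) = P (good ∪ goodᶜ) := by rw [Set.union_compl_self, measure_univ]
    _ ≤ P good + P goodᶜ := measure_union_le _ _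
    _ ≤ P good + ENNReal.ofReal I.delta := by gcongr
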